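/- Let $\mathbb K$ be $\mathbb R$ or $\mathbb C$, and let $\mathbb M_{m,n}$ be the space of $m\times n$ matrices over $\mathbb K$ with the Frobenius inner product. Let $\mathcal H\subset\mathbb M_{m,n}$ be a linear subspace, let $\mathcal P_{\mathcal H}$ and $\mathcal P_{\mathcal H^\perp}$ be the orthogonal projections onto $\mathcal H$ and $\mathcal H^\perp$, let $\mathcal V$ be a finite-dimensional inner product space over $\mathbb K$, let $M:\mathcal H\to\mathcal V$ be linear, $h\in\mathcal V$, $\tau>0$ and $1<q<\infty$. Write $\sigma_j(A)$, $1\le j\le\min(m,n)$, for the singular values of $A$, and set $$\mathcal R_\tau(A)=\sum_{j}\Big(\tau^2-\max(\tau-\sigma_j(A),0)^2\Big),\qquad s(\sigma)=\max\big(\min(\sigma,\tau),\sigma/q\big).$$ For a matrix $A$ with singular value decomposition $A=U\,\mathrm{diag}(\sigma_j(A))\,V^*$ let $\mathfrak S_s(A)=U\,\mathrm{diag}(s(\sigma_j(A)))\,V^*$, which does not depend on the choice of the decomposition. Define the map $(W,A)\mapsto(W',A')=\mathfrak B^M_{h,\tau,q}(W,A)$ on $\mathbb M_{m,n}\times\mathcal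 H$ by $$W'=\mathfrak S_s\big(q(M^*(h-MA)+A)+\mathcal P_{\mathcal H^\perp}W\big),\qquad A'=\frac1{q-1}\big(q(M^*(h-MA)+A)-\mathcal P_{\mathcal H}W'\big).$$ Consider the functional $J(A)=\mathcal R_\tau(A)+q\|MA-h\|_{\mathcal V}^2$ on $\mathcal H$. A point $A^\circ\in\mathcal H$ is called a stationary point of $J$ if $0$ belongs to the (Fréchet) subdifferential of $J$ at $A^\circ$, that is, if $J(A)\ge J(A^\circ)+o(\|A-A^\circ\|)$ as $A\to A^\circ$ in $\mathcal H$. For self-adjoint operators on $\mathcal H$, $S\ge T$ means that $S-T$ is positive semidefinite and $S>T$ that $S-T$ is positive definite; $I$ is the identity on $\mathcal H$. **Theorem.** Suppose that $M^*M\le I$. Then: 1. A point $A^\circ\in\mathcal H$ is a stationary point of $J$ if and only if there is $W^\circ\in\mathbb M_{m,n}$ such that $(W^\circ,A^\circ)$ is a fixed point of $\mathfrak B^M_{h,\tau,q}$. 2. $J$ is convex if $qM^*M\ge I$. 3. $J$ is strictly convex if $qM^*M>I$. -/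

import Mathlib

open scoped Topology

/-! ### The Euclidean space of matrices -/

-- Matrices carry the Frobenius norm `‖A‖ = √(∑ |A i j|²)`.
attribute [local instance] Matrix.frobeniusNormedAddCommGroup Matrix.frobeniusNormedSpace

namespace LowRank

/-- The Frobenius norm is induced by the inner product `⟨A, B⟩ = tr (Aᴴ B)`. -/
noncomputable instance frobeniusInnerProductSpace {𝕜 : Type*} [RCLike 𝕜] {m n : ℕ} :
    InnerProductSpace 𝕜 (Matrix (Fin m) (Fin n) 𝕜) where
  inner A B := (A.conjTranspose * B).trace
  norm_sq_eq_re_inner A := by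
    have h0 : 0 ≤ ∑ i, ∑ j, ‖A i j‖ ^ (2 : ℝ) := by positivity
    rw [Matrix.frobenius_norm_def, ← Real.sqrt_eq_rpow, Real.sq_sqrt h0, Finset.sum_comm]
    simp only [Matrix.trace, Matrix.diag, Matrix.mul_apply, Matrix.conjTranspose_apply, map_sum]
    refine Finset.sum_congr rfl fun i _ => Finset.sum_congr rfl fun j _ => ?_
    rw [RCLike.star_def, RCLike.conj_mul]
    norm_cast
  conj_inner_symm A B := by
    rw [← RCLike.star_def, ← Matrix.trace_conjTranspose, Matrix.conjTranspose_mul,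
      Matrix.conjTranspose_conjTranspose]
  add_left A B C := by
    rw [Matrix.conjTranspose_add, Matrix.add_mul, Matrix.trace_add]
  smul_left A B r := by
    rw [Matrix.conjTranspose_smul, Matrix.smul_mul, Matrix.trace_smul, smul_eq_mul,
      RCLike.star_def]

/-! ### Singular values and the singular value functional calculus -/

/-- The `j`-th singular value of `A` (in decreasing order with multiplicity, counted from `0`,
and `0` for `j ≥ min m n`). -/
noncomputable def singularValue {𝕜 : Type*} [RCLike 𝕜] {m n : ℕ}
    (A : Matrix (Fin m) (Fin n) 𝕜) (j : ℕ) : ℝ :=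
  (Matrix.toEuclideanLin A).singularValues j

/-- The `m × n` matrix with the entries `σ 0, σ 1, …` on its main diagonal. -/
def rectDiag (𝕜 : Type*) [RCLike 𝕜] (m n : ℕ) (σ : ℕ → ℝ) : Matrix (Fin m) (Fin n) 𝕜 :=
  Matrix.of fun i j => if (i : ℕ) = (j : ℕ) then (σ i : 𝕜) else 0

/-- `A = U diag(σ_j(A)) Vᴴ` is a singular value decomposition of `A`. -/
structure IsSVD {𝕜 : Type*} [RCLike 𝕜] {m n : ℕ} (A : Matrix (Fin m) (Fin n) 𝕜)
    (U : Matrix (Fin m) (Fin m) 𝕜) (V : Matrix (Fin n) (Fin n) 𝕜) : Prop where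
  left_unitary : U ∈ Matrix.unitaryGroup (Fin m) 𝕜
  right_unitary : V ∈ Matrix.unitaryGroup (Fin n) 𝕜
  eq_mul : A = U * rectDiag 𝕜 m n (singularValue A) * V.conjTranspose

theorem exists_isSVD {𝕜 : Type*} [RCLike 𝕜] {m n : ℕ} (A : Matrix (Fin m) (Fin n) 𝕜) :
    ∃ U V, IsSVD A U V := by
  set T := Matrix.toEuclideanLin A with hT
  have hn : Module.finrank 𝕜 (EuclideanSpace 𝕜 (Fin n)) = n := by simp
  have hm : Module.finrank 𝕜 (EuclideanSpace 𝕜 (Fin m)) = m := by simp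
  have hσ0 : ∀ j, 0 ≤ singularValue A j := fun j => T.singularValues_nonneg j
  have hσn : ∀ j, 0 < singularValue A j → j < n := by
    intro j hj
    by_contra hjn
    exact hj.ne' (T.singularValues_of_finrank_le (by omega))
  have hσm : ∀ j, 0 < singularValue A j → j < m := by
    intro j hj
    have h1 : j < Module.finrank 𝕜 T.range := T.singularValues_pos_iff_lt_finrank_range.1 hj
    have h2 : Module.finrank 𝕜 T.range ≤ _ := Submodule.finrank_le T.range
    omega
  let b := T.isSymmetric_adjoint_comp_self.eigenvectorBasis hn
  have hb : ∀ i j : Fin n, inner 𝕜 (T (b i)) (T (b j)) =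
      if i = j then ((singularValue A j : ℝ) : 𝕜) ^ 2 else 0 := by
    intro i j
    have h1 : LinearMap.adjoint T (T (b j)) = ((singularValue A j : ℝ) : 𝕜) ^ 2 • b j := by
      have h2 := T.isSymmetric_adjoint_comp_self.apply_eigenvectorBasis hn j
      refine h2.trans ?_
      rw [← T.sq_singularValues_fin hn j, RCLike.ofReal_pow]
      rfl
    rw [← LinearMap.adjoint_inner_right, h1, inner_smul_right,
      orthonormal_iff_ite.1 b.orthonormal i j]
    simp
  let v : Fin m → EuclideanSpace 𝕜 (Fin m) := fun i =>
    if h : (i : ℕ) < n then ((singularValue A i : ℝ) : 𝕜)⁻¹ • T (b ⟨i, h⟩) else 0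
  let s : Set (Fin m) := {i | 0 < singularValue A i}
  have hv : Orthonormal 𝕜 (s.domRestrict v) := by
    rw [orthonormal_iff_ite]
    rintro ⟨i, hi⟩ ⟨j, hj⟩
    have hi' : 0 < singularValue A i := hi
    have hj' : 0 < singularValue A j := hj
    have hjne : ((singularValue A j : ℝ) : 𝕜) ≠ 0 := by exact_mod_cast hj'.ne'
    simp only [Set.domRestrict_apply, v, dif_pos (hσn _ hi'), dif_pos (hσn _ hj'),
      inner_smul_left, inner_smul_right, hb, Subtype.mk.injEq, Fin.mk.injEq, Fin.val_inj]
    split_ifs with hij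
    · subst hij
      rw [map_inv₀, RCLike.conj_ofReal]
      field_simp
    · simp
  obtain ⟨c, hc⟩ := hv.exists_orthonormalBasis_extension_of_card_eq (by simp)
  let U := (EuclideanSpace.basisFun (Fin m) 𝕜).toBasis.toMatrix c
  let V := (EuclideanSpace.basisFun (Fin n) 𝕜).toBasis.toMatrix b
  have hU : U ∈ Matrix.unitaryGroup (Fin m) 𝕜 :=
    (EuclideanSpace.basisFun (Fin m) 𝕜).toMatrix_orthonormalBasis_mem_unitary c
  have hV : V ∈ Matrix.unitaryGroup (Fin n) 𝕜 :=
    (EuclideanSpace.basisFun (Fin n) 𝕜).toMatrix_orthonormalBasis_mem_unitary b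
  have hUe : ∀ i k, U i k = c k i := fun i k => by simp [U, Module.Basis.toMatrix_apply]
  have hVe : ∀ i k, V i k = b k i := fun i k => by simp [V, Module.Basis.toMatrix_apply]
  refine ⟨U, V, hU, hV, ?_⟩
  have key : A * V = U * rectDiag 𝕜 m n (singularValue A) := by
    ext i j
    have hL : (A * V) i j = T (b j) i := by
      simp [hT, Matrix.mul_apply, hVe, Matrix.toLpLin_apply, Matrix.mulVec, dotProduct]
    rw [hL, Matrix.mul_apply]
    rcases (hσ0 j).eq_or_lt with h0 | hpos
    · have hz : T (b j) = 0 := by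
        have h3 := hb j j
        rw [if_pos rfl, ← h0] at h3
        simpa using h3
      rw [hz]
      refine (Finset.sum_eq_zero fun k _ => ?_).symm
      simp only [rectDiag, Matrix.of_apply]
      split_ifs with hk
      · rw [hk, ← h0]; simp
      · simp
    · have hjm := hσm j hpos
      have hne : ((singularValue A j : ℝ) : 𝕜) ≠ 0 := by exact_mod_cast hpos.ne'
      rw [Finset.sum_eq_single (⟨j, hjm⟩ : Fin m)]
      · have h4 := hc ⟨j, hjm⟩ hpos
        simp only [v, dif_pos j.isLt] at h4
        rw [hUe, h4]
        simp only [rectDiag, Matrix.of_apply, if_true, PiLp.smul_apply, smul_eq_mul]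
        field_simp
      · intro k _ hk
        have : (k : ℕ) ≠ j := fun h => hk (Fin.ext h)
        simp [rectDiag, this]
      · simp
  rw [← key, Matrix.mul_assoc, ← Matrix.star_eq_conjTranspose, Matrix.mem_unitaryGroup_iff.1 hV,
    Matrix.mul_one]

/-- The singular value functional calculus `𝔖_f(A) = U diag(f(σ_j(A))) Vᴴ`, where
`A = U diag(σ_j(A)) Vᴴ` is a singular value decomposition of `A`. By `svCalculus_eq` the choice
of the decomposition is irrelevant if `f 0 = 0`. -/
noncomputable def svCalculus {𝕜 : Type*} [RCLike 𝕜] {m n : ℕ} (f : ℝ → ℝ)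
    (A : Matrix (Fin m) (Fin n) 𝕜) : Matrix (Fin m) (Fin n) 𝕜 :=
  (exists_isSVD A).choose * rectDiag 𝕜 m n (fun j => f (singularValue A j)) *
    (exists_isSVD A).choose_spec.choose.conjTranspose

theorem rectDiag_intertwine {𝕜 : Type*} [RCLike 𝕜] {m n : ℕ} {f : ℝ → ℝ} (hf : f 0 = 0)
    {σ : ℕ → ℝ} (hσ : ∀ j, 0 ≤ σ j) {P : Matrix (Fin m) (Fin m) 𝕜} {Q : Matrix (Fin n) (Fin n) 𝕜}
    (h1 : P * rectDiag 𝕜 m n σ = rectDiag 𝕜 m n σ * Q)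
    (h2 : rectDiag 𝕜 n m σ * P = Q * rectDiag 𝕜 n m σ) :
    P * rectDiag 𝕜 m n (fun j => f (σ j)) = rectDiag 𝕜 m n (fun j => f (σ j)) * Q := by
  have eL : ∀ (a b : ℕ) (g : ℕ → ℝ) (X : Matrix (Fin a) (Fin a) 𝕜) (i : Fin a) (j : Fin b),
      (X * rectDiag 𝕜 a b g) i j = if h : (j : ℕ) < a then X i ⟨j, h⟩ * (g j : 𝕜) else 0 := by
    intro a b g X i j
    rw [Matrix.mul_apply]
    split_ifs with h
    · rw [Finset.sum_eq_single (⟨j, h⟩ : Fin a)]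
      · simp [rectDiag]
      · intro k _ hk
        have : (k : ℕ) ≠ j := fun h => hk (Fin.ext h)
        simp [rectDiag, this]
      · simp
    · refine Finset.sum_eq_zero fun k _ => ?_
      have : (k : ℕ) ≠ j := by omega
      simp [rectDiag, this]
  have eR : ∀ (a b : ℕ) (g : ℕ → ℝ) (X : Matrix (Fin b) (Fin b) 𝕜) (i : Fin a) (j : Fin b),
      (rectDiag 𝕜 a b g * X) i j = if h : (i : ℕ) < b then (g i : 𝕜) * X ⟨i, h⟩ j else 0 := by
    intro a b g X i j
    rw [Matrix.mul_apply]
    split_ifs with h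
    · rw [Finset.sum_eq_single (⟨i, h⟩ : Fin b)]
      · simp [rectDiag]
      · intro k _ hk
        have : (i : ℕ) ≠ k := fun h => hk (Fin.ext h.symm)
        simp [rectDiag, this]
      · simp
    · refine Finset.sum_eq_zero fun k _ => ?_
      have : (i : ℕ) ≠ k := by omega
      simp [rectDiag, this]
  ext i j
  have a1 := congrFun (congrFun h1 i) j
  rw [eL, eR] at a1 ⊢
  by_cases hj : (j : ℕ) < m <;> by_cases hi : (i : ℕ) < n <;>
    simp only [hi, hj, dite_true, dite_false] at a1 ⊢
  · have a2 := congrFun (congrFun h2 ⟨i, hi⟩) ⟨j, hj⟩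
    rw [eL, eR] at a2
    simp only [Fin.is_lt, dite_true, Fin.eta] at a2
    by_cases hs : σ i = σ j
    · rw [hs] at a1 ⊢
      by_cases h0 : σ j = 0
      · simp [h0, hf]
      · have h0' : ((σ j : ℝ) : 𝕜) ≠ 0 := by exact_mod_cast h0
        rw [mul_comm] at a1
        rw [mul_left_cancel₀ h0' a1, mul_comm]
    · have hne : ((σ i : ℝ) : 𝕜) ^ 2 - ((σ j : ℝ) : 𝕜) ^ 2 ≠ 0 := by
        intro h
        have h' : (σ i) ^ 2 = (σ j) ^ 2 := by exact_mod_cast sub_eq_zero.1 h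
        exact hs ((sq_eq_sq₀ (hσ _) (hσ _)).1 h')
      have p0 : P i ⟨j, hj⟩ = 0 := by
        refine (mul_eq_zero.1 (?_ : (((σ i : ℝ) : 𝕜) ^ 2 - ((σ j : ℝ) : 𝕜) ^ 2) * _ = 0)).resolve_left
          hne
        linear_combination ((σ i : ℝ) : 𝕜) * a2 - ((σ j : ℝ) : 𝕜) * a1
      have q0 : Q ⟨i, hi⟩ j = 0 := by
        refine (mul_eq_zero.1 (?_ : (((σ i : ℝ) : 𝕜) ^ 2 - ((σ j : ℝ) : 𝕜) ^ 2) * _ = 0)).resolve_left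
          hne
        linear_combination ((σ j : ℝ) : 𝕜) * a2 - ((σ i : ℝ) : 𝕜) * a1
      rw [p0, q0]; simp
  · rcases mul_eq_zero.1 a1 with h | h
    · simp [h]
    · have : σ j = 0 := by exact_mod_cast h
      simp [this, hf]
  · rcases mul_eq_zero.1 a1.symm with h | h
    · have : σ i = 0 := by exact_mod_cast h
      simp [this, hf]
    · simp [h]

theorem rectDiag_conjTranspose {𝕜 : Type*} [RCLike 𝕜] (m n : ℕ) (σ : ℕ → ℝ) :
    (rectDiag 𝕜 m n σ).conjTranspose = rectDiag 𝕜 n m σ := by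
  ext i j
  simp only [rectDiag, Matrix.conjTranspose_apply, Matrix.of_apply]
  by_cases h : (i : ℕ) = j
  · simp [h]
  · simp [h, Ne.symm h]

theorem svCalculus_eq {𝕜 : Type*} [RCLike 𝕜] {m n : ℕ} {f : ℝ → ℝ} (hf : f 0 = 0)
    {A : Matrix (Fin m) (Fin n) 𝕜} {U : Matrix (Fin m) (Fin m) 𝕜}
    {V : Matrix (Fin n) (Fin n) 𝕜} (h : IsSVD A U V) :
    svCalculus f A = U * rectDiag 𝕜 m n (fun j => f (singularValue A j)) * V.conjTranspose := by
  obtain ⟨hU, hV, hA⟩ := h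
  obtain ⟨hU', hV', hA'⟩ := (exists_isSVD A).choose_spec.choose_spec
  rw [svCalculus]
  set U' := (exists_isSVD A).choose
  set V' := (exists_isSVD A).choose_spec.choose
  set D := rectDiag 𝕜 m n (singularValue A) with hD
  have u1 : U.conjTranspose * U = 1 := Matrix.mem_unitaryGroup_iff'.1 hU
  have u2 : U * U.conjTranspose = 1 := Matrix.mem_unitaryGroup_iff.1 hU
  have v1 : V.conjTranspose * V = 1 := Matrix.mem_unitaryGroup_iff'.1 hV
  have v1' : V'.conjTranspose * V' = 1 := Matrix.mem_unitaryGroup_iff'.1 hV'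
  have v2' : V' * V'.conjTranspose = 1 := Matrix.mem_unitaryGroup_iff.1 hV'
  have u1' : U'.conjTranspose * U' = 1 := Matrix.mem_unitaryGroup_iff'.1 hU'
  have v2 : V * V.conjTranspose = 1 := Matrix.mem_unitaryGroup_iff.1 hV
  have h1 : (U.conjTranspose * U') * D = D * (V.conjTranspose * V') := by
    calc (U.conjTranspose * U') * D = U.conjTranspose * (U' * D * V'.conjTranspose) * V' := by
          simp only [Matrix.mul_assoc, v1', Matrix.mul_one]
      _ = U.conjTranspose * (U * D * V.conjTranspose) * V' := by rw [← hA', ← hA]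
      _ = (U.conjTranspose * U) * D * (V.conjTranspose * V') := by simp only [Matrix.mul_assoc]
      _ = D * (V.conjTranspose * V') := by rw [u1, Matrix.one_mul]
  have hAc : U' * D * V'.conjTranspose = U * D * V.conjTranspose := by rw [← hA', ← hA]
  have hAd := congrArg Matrix.conjTranspose hAc
  simp only [Matrix.conjTranspose_mul, Matrix.conjTranspose_conjTranspose, hD,
    rectDiag_conjTranspose] at hAd
  set E := rectDiag 𝕜 n m (singularValue A)
  have h2 : E * (U.conjTranspose * U') = (V.conjTranspose * V') * E := by
    calc E * (U.conjTranspose * U') = (V.conjTranspose * V) * E * (U.conjTranspose * U') := by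
          rw [v1, Matrix.one_mul]
      _ = V.conjTranspose * (V * (E * U.conjTranspose)) * U' := by simp only [Matrix.mul_assoc]
      _ = V.conjTranspose * (V' * (E * U'.conjTranspose)) * U' := by rw [hAd]
      _ = (V.conjTranspose * V') * E * (U'.conjTranspose * U') := by simp only [Matrix.mul_assoc]
      _ = (V.conjTranspose * V') * E := by rw [u1', Matrix.mul_one]
  have h3 := rectDiag_intertwine hf
    (fun j => (Matrix.toEuclideanLin A).singularValues_nonneg j) h1 h2
  change _ * rectDiag 𝕜 m n (fun j => f (singularValue A j)) =
    rectDiag 𝕜 m n (fun j => f (singularValue A j)) * _ at h3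
  set G := rectDiag 𝕜 m n (fun j => f (singularValue A j))
  calc U' * G * V'.conjTranspose = (U * U.conjTranspose) * U' * G * V'.conjTranspose := by
        rw [u2, Matrix.one_mul]
    _ = U * ((U.conjTranspose * U') * G) * V'.conjTranspose := by simp only [Matrix.mul_assoc]
    _ = U * G * V.conjTranspose * (V' * V'.conjTranspose) := by
        rw [h3]; simp only [Matrix.mul_assoc]
    _ = U * G * V.conjTranspose := by rw [v2', Matrix.mul_one]

/-- `s_{τ,q}(σ) = max (min σ τ) (σ / q)`. -/
noncomputable def shrink (τ q : ℝ) (σ : ℝ) : ℝ := max (min σ τ) (σ / q)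

/-! ### The objective functional and its stationary points -/

/-- `R_τ(A) = ∑_j (τ² - max(τ - σ_j(A), 0)²)`. -/
noncomputable def rankReg {𝕜 : Type*} [RCLike 𝕜] {m n : ℕ} (τ : ℝ)
    (A : Matrix (Fin m) (Fin n) 𝕜) : ℝ :=
  ∑ j ∈ Finset.range (min m n), (τ ^ 2 - max (τ - singularValue A j) 0 ^ 2)

/-- The functional `A ↦ R_τ(A) + q ‖M A - h‖²` on the subspace `H`. -/
noncomputable def objective {𝕜 : Type*} [RCLike 𝕜] {m n : ℕ}
    {H : Submodule 𝕜 (Matrix (Fin m) (Fin n) 𝕜)} {V : Type*} [NormedAddCommGroup V]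
    [InnerProductSpace 𝕜 V] (M : H →ₗ[𝕜] V) (h : V) (τ q : ℝ) (A : H) : ℝ :=
  rankReg τ (A : Matrix (Fin m) (Fin n) 𝕜) + q * ‖M A - h‖ ^ 2

/-- The (regular, or Fréchet) subdifferential of `f` at `x`: all `g` with
`f y ≥ f x + Re ⟨g, y - x⟩ + o(‖y - x‖)` as `y → x`. -/
def subdifferential (𝕜 : Type*) [RCLike 𝕜] {E : Type*} [NormedAddCommGroup E]
    [InnerProductSpace 𝕜 E] (f : E → ℝ) (x : E) : Set E :=
  {g | ∀ ε > 0, ∀ᶠ y in 𝓝 x, f x + RCLike.re (inner 𝕜 g (y - x)) - ε * ‖y - x‖ ≤ f y}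

/-- `x` is a stationary point of the (possibly non-smooth and non-convex) functional `f` if `0`
belongs to the subdifferential of `f` at `x`. -/
def IsStationaryPoint (𝕜 : Type*) [RCLike 𝕜] {E : Type*} [NormedAddCommGroup E]
    [InnerProductSpace 𝕜 E] (f : E → ℝ) (x : E) : Prop :=
  (0 : E) ∈ subdifferential 𝕜 f x

/-! ### The fixed point map -/

/-- The vector `M* (h - M A) + A` of `H`. -/
noncomputable def gradStep {𝕜 : Type*} [RCLike 𝕜] {m n : ℕ}
    {H : Submodule 𝕜 (Matrix (Fin m) (Fin n) 𝕜)} {V : Type*} [NormedAddCommGroup V]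
    [InnerProductSpace 𝕜 V] [FiniteDimensional 𝕜 V] (M : H →ₗ[𝕜] V) (h : V) (A : H) : H :=
  LinearMap.adjoint M (h - M A) + A

/-- First component of the map below: `W' = 𝔖_s(q (M* (h - M A) + A) + P_{Hᗮ} W)`. -/
noncomputable def nextW {𝕜 : Type*} [RCLike 𝕜] {m n : ℕ}
    {H : Submodule 𝕜 (Matrix (Fin m) (Fin n) 𝕜)} {V : Type*} [NormedAddCommGroup V]
    [InnerProductSpace 𝕜 V] [FiniteDimensional 𝕜 V] (M : H →ₗ[𝕜] V) (h : V) (τ q : ℝ)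
    (W : Matrix (Fin m) (Fin n) 𝕜) (A : H) : Matrix (Fin m) (Fin n) 𝕜 :=
  svCalculus (shrink τ q) (q • (gradStep M h A : Matrix (Fin m) (Fin n) 𝕜) + Hᗮ.starProjection W)

/-- The map `(W, A) ↦ (W', A')`, where `W' = 𝔖_s(q (M* (h - M A) + A) + P_{Hᗮ} W)` and
`A' = (q - 1)⁻¹ (q (M* (h - M A) + A) - P_H W')`. -/
noncomputable def fixedPointMap {𝕜 : Type*} [RCLike 𝕜] {m n : ℕ}
    {H : Submodule 𝕜 (Matrix (Fin m) (Fin n) 𝕜)} {V : Type*} [NormedAddCommGroup V]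
    [InnerProductSpace 𝕜 V] [FiniteDimensional 𝕜 V] (M : H →ₗ[𝕜] V) (h : V) (τ q : ℝ)
    (x : Matrix (Fin m) (Fin n) 𝕜 × H) : Matrix (Fin m) (Fin n) 𝕜 × H :=
  (nextW M h τ q x.1 x.2,
    (q - 1)⁻¹ • (q • gradStep M h x.2 - H.orthogonalProjectionOnto (nextW M h τ q x.1 x.2)))

/-- `S < T` for self-adjoint `S`, `T` in the sense that `T - S` is positive definite (which is
stronger than `S ≤ T ∧ S ≠ T`). -/
def StrictLoewner {𝕜 : Type*} [RCLike 𝕜] {E : Type*} [NormedAddCommGroup E]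
    [InnerProductSpace 𝕜 E] (S T : E →ₗ[𝕜] E) : Prop :=
  (T - S).IsSymmetric ∧ ∀ x, x ≠ 0 → 0 < RCLike.re (inner 𝕜 ((T - S) x) x)

end LowRank

namespace LowRank

/-! ### Supporting functionals of convex functions -/

/-! Write `J(A) = G(A) + (q‖MA - h‖² - ‖A‖²)` with `G = R_τ + ‖·‖²`. Here `G` is convex, being the
sum of `penalty τ` over the singular values, and the rest is quadratic with second-order part
`q‖MD‖² - ‖D‖²`, the form of `qM*M - I`. Adding a supporting functional of `G` to the expansion of
the quadratic gives parts 2 and 3 (`objective_supporting`).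

For part 1, `A` is stationary iff half the negative gradient of the quadratic is half a subgradient
of `G` restricted to `H`. By Hahn–Banach such a vector is `P_H W` with `2W` a subgradient of `G` on
all matrices. The calculus `𝔖_s` is a resolvent: `2W ∈ ∂G(A)` iff `𝔖_s((q-1)A + W) = W`
(`isHalfSubgradient_iff`). Together with the formula for `P_H W` this is the fixed point equation
(`isFixedPt_iff`).

Subgradients of `G` are found in singular bases. The matrix input is `sum_penalty_diagEntry_le`,
where Jensen's inequality with doubly substochastic weights plays the role of von Neumann's trace
inequality. -/

theorem convexOn_of_supporting {E : Type*} [AddCommGroup E] [Module ℝ E] {f : E → ℝ}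
    (hf : ∀ x, ∃ l : E →ₗ[ℝ] ℝ, ∀ y, f x + l (y - x) ≤ f y) : ConvexOn ℝ Set.univ f := by
  refine ⟨convex_univ, fun x _ y _ a b ha hb hab => ?_⟩
  obtain ⟨l, hl⟩ := hf (a • x + b • y)
  have hx := mul_le_mul_of_nonneg_left (hl x) ha
  have hy := mul_le_mul_of_nonneg_left (hl y) hb
  have h0 : a * l (x - (a • x + b • y)) + b * l (y - (a • x + b • y)) = 0 := by
    simp only [map_sub, map_add, map_smul, smul_eq_mul]
    linear_combination (-(a * l x + b * l y)) * hab
  have h1 : a * f (a • x + b • y) + b * f (a • x + b • y) = f (a • x + b • y) := by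
    rw [← add_mul, hab, one_mul]
  simp only [smul_eq_mul]
  linarith

theorem strictConvexOn_of_supporting {E : Type*} [AddCommGroup E] [Module ℝ E] {f : E → ℝ}
    (hf : ∀ x, ∃ l : E →ₗ[ℝ] ℝ, ∀ y, y ≠ x → f x + l (y - x) < f y) :
    StrictConvexOn ℝ Set.univ f := by
  refine ⟨convex_univ, fun x _ y _ hxy a b ha hb hab => ?_⟩
  obtain ⟨l, hl⟩ := hf (a • x + b • y)
  have hne : x ≠ a • x + b • y := by
    intro h
    apply hxy
    have h2 : b • (x - y) = 0 := by
      have : b • (x - y) = (a + b) • x - (a • x + b • y) := by module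
      rw [this, hab, one_smul, ← h, sub_self]
    exact sub_eq_zero.1 ((smul_eq_zero.1 h2).resolve_left hb.ne')
  have hne' : y ≠ a • x + b • y := by
    intro h
    apply hxy
    have h2 : a • (x - y) = 0 := by
      have : a • (x - y) = (a • x + b • y) - (a + b) • y := by module
      rw [this, hab, one_smul, ← h, sub_self]
    exact sub_eq_zero.1 ((smul_eq_zero.1 h2).resolve_left ha.ne')
  have hx := mul_lt_mul_of_pos_left (hl x hne) ha
  have hy := mul_lt_mul_of_pos_left (hl y hne') hb
  have h0 : a * l (x - (a • x + b • y)) + b * l (y - (a • x + b • y)) = 0 := by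
    simp only [map_sub, map_add, map_smul, smul_eq_mul]
    linear_combination (-(a * l x + b * l y)) * hab
  have h1 : a * f (a • x + b • y) + b * f (a • x + b • y) = f (a • x + b • y) := by
    rw [← add_mul, hab, one_mul]
  simp only [smul_eq_mul]
  linarith

/-- The Hahn–Banach theorem for subgradients: a subgradient of the restriction of a convex function
to a subspace extends to a subgradient on the whole space. -/
theorem exists_subgradient_extension {E : Type*} [AddCommGroup E] [Module ℝ E] {g : E → ℝ}
    (hg : ConvexOn ℝ Set.univ g) (x : E) (f : E →ₗ.[ℝ] ℝ)
    (hf : ∀ d : f.domain, g x + f d ≤ g (x + d)) :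
    ∃ l : E →ₗ[ℝ] ℝ, (∀ d : f.domain, l d = f d) ∧ ∀ d, g x + l d ≤ g (x + d) := by
  -- The infimum over `t > 0` of these difference quotients is the directional derivative of `g` at
  -- `x`. It is sublinear and dominates `f`.
  let Q : E → Set.Ioi (0 : ℝ) → ℝ := fun d t => (g (x + (t : ℝ) • d) - g x) / t
  have hbdd : ∀ d, BddBelow (Set.range (Q d)) := by
    refine fun d => ⟨g x - g (x - d), ?_⟩
    rintro _ ⟨⟨t, ht⟩, rfl⟩
    have ht' : (0 : ℝ) < t := ht
    rw [le_div_iff₀ ht']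
    -- `x` lies between `x - d` and `x + t • d`, which bounds the quotients below independently of
    -- `t`.
    have h := hg.2 (Set.mem_univ (x - d)) (Set.mem_univ (x + t • d))
      (show 0 ≤ t / (1 + t) by positivity) (show 0 ≤ 1 / (1 + t) by positivity)
      (by field_simp; ring)
    have e : (t / (1 + t)) • (x - d) + (1 / (1 + t)) • (x + t • d) = x := by
      match_scalars <;> (field_simp; try ring)
    rw [e, smul_eq_mul, smul_eq_mul, div_mul_eq_mul_div, div_mul_eq_mul_div, ← add_div,
      le_div_iff₀ (by positivity)] at h
    simp only
    linarith
  let N : E → ℝ := fun d => ⨅ t, Q d t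
  have hNle : ∀ d (t : ℝ), 0 < t → N d ≤ (g (x + t • d) - g x) / t := fun d t ht =>
    ciInf_le (hbdd d) ⟨t, ht⟩
  have : Nonempty (Set.Ioi (0 : ℝ)) := ⟨⟨1, Set.mem_Ioi.2 one_pos⟩⟩
  have hle1 : ∀ c : ℝ, 0 < c → ∀ d, N (c • d) ≤ c * N d := by
    intro c hc d
    rw [← div_le_iff₀' hc]
    refine le_ciInf ?_
    rintro ⟨t, ht⟩
    have ht' : (0 : ℝ) < t := ht
    rw [div_le_iff₀' hc]
    refine (hNle (c • d) (t / c) (by positivity)).trans (le_of_eq ?_)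
    have : (t / c) • c • d = t • d := by rw [smul_smul, div_mul_cancel₀ _ hc.ne']
    simp only [Q, this]
    field_simp
  have hsmul : ∀ c : ℝ, 0 < c → ∀ d, N (c • d) = c * N d := by
    intro c hc d
    refine le_antisymm (hle1 c hc d) ?_
    have h := hle1 c⁻¹ (inv_pos.2 hc) (c • d)
    rw [smul_smul, inv_mul_cancel₀ hc.ne', one_smul] at h
    rwa [← div_eq_inv_mul, le_div_iff₀' hc] at h
  have hadd : ∀ d e, N (d + e) ≤ N d + N e := by
    intro d e
    refine le_ciInf_add_ciInf ?_
    rintro ⟨s, hs⟩ ⟨t, ht⟩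
    have hs' : (0 : ℝ) < s := hs
    have ht' : (0 : ℝ) < t := ht
    -- With this step size, `x + (s * t / (s + t)) • (d + e)` is a convex combination of `x + s • d`
    -- and `x + t • e`.
    refine (hNle (d + e) (s * t / (s + t)) (by positivity)).trans ?_
    have h := hg.2 (Set.mem_univ (x + s • d)) (Set.mem_univ (x + t • e))
      (show 0 ≤ t / (s + t) by positivity) (show 0 ≤ s / (s + t) by positivity)
      (by field_simp; ring)
    have e1 : (t / (s + t)) • (x + s • d) + (s / (s + t)) • (x + t • e)
        = x + (s * t / (s + t)) • (d + e) := by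
      match_scalars <;> (field_simp; try ring)
    rw [e1, smul_eq_mul, smul_eq_mul] at h
    rw [div_le_iff₀ (by positivity)]
    refine (sub_le_sub_right h _).trans (le_of_eq ?_)
    simp only [Q]
    field_simp
    ring
  have hdom : ∀ d : f.domain, f d ≤ N d := by
    intro d
    refine le_ciInf ?_
    rintro ⟨t, ht⟩
    have ht' : (0 : ℝ) < t := ht
    simp only [Q]
    rw [le_div_iff₀ ht']
    have h := hf (t • d)
    rw [LinearPMap.map_smul, smul_eq_mul, Submodule.coe_smul] at h
    linarith
  obtain ⟨l, hl1, hl2⟩ := exists_extension_of_le_sublinear f N hsmul hadd hdom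
  refine ⟨l, hl1, fun d => ?_⟩
  have := (hl2 d).trans (hNle d 1 one_pos)
  rw [one_smul, div_one] at this
  linarith

/-! ### The scalar penalty -/

/-- The convex function `t ↦ τ² - max (τ - t) 0 ² + t²`, whose sum over the singular values of `A`
is `R_τ(A) + ‖A‖²`. -/
noncomputable def penalty (τ t : ℝ) : ℝ := τ ^ 2 - max (τ - t) 0 ^ 2 + t ^ 2

theorem penalty_zero {τ : ℝ} (hτ : 0 ≤ τ) : penalty τ 0 = 0 := by
  simp [penalty, hτ]

theorem penalty_of_le {τ t : ℝ} (h : t ≤ τ) : penalty τ t = 2 * τ * t := by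
  rw [penalty, max_eq_left (by linarith)]; ring

theorem penalty_of_ge {τ t : ℝ} (h : τ ≤ t) : penalty τ t = τ ^ 2 + t ^ 2 := by
  rw [penalty, max_eq_right (by linarith)]; ring

/-- Half the subdifferential of the even extension of `penalty τ` at `a ≥ 0`, cut down to the
nonnegative half line. -/
def IsHalfSlope (τ a w : ℝ) : Prop := 0 ≤ w ∧ (a = 0 ∧ w ≤ τ ∨ w = max a τ)

theorem isHalfSlope_max {τ : ℝ} (hτ : 0 ≤ τ) (a : ℝ) : IsHalfSlope τ a (max a τ) :=
  ⟨hτ.trans (le_max_right _ _), Or.inr rfl⟩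

/-- On `[0, ∞)` the penalty is the line `2τt` up to `τ`, continued by the parabola `τ² + t²`, which
is tangent to that line at `τ`; hence it is convex. -/
theorem penalty_add_le_of_isHalfSlope {τ a w b : ℝ} (hτ : 0 ≤ τ) (hw : IsHalfSlope τ a w)
    (hb : 0 ≤ b) : penalty τ a + 2 * w * (b - a) ≤ penalty τ b := by
  have key : penalty τ b ≥ 2 * τ * b := by
    rcases le_total b τ with h | h
    · rw [penalty_of_le h]
    · rw [penalty_of_ge h]; nlinarith [sq_nonneg (b - τ)]
  obtain ⟨hw0, ⟨rfl, hwτ⟩ | rfl⟩ := hw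
  · rw [penalty_zero hτ]
    nlinarith
  · rcases le_total a τ with h | h
    · rw [max_eq_right h, penalty_of_le h]
      linarith
    · rw [max_eq_left h, penalty_of_ge h]
      rcases le_total b τ with h' | h'
      · rw [penalty_of_le h']; nlinarith [sq_nonneg (a - τ)]
      · rw [penalty_of_ge h']; nlinarith [sq_nonneg (a - b)]

theorem penalty_add_re_le {𝕜 : Type*} [RCLike 𝕜] {τ a w : ℝ} (hτ : 0 ≤ τ)
    (hw : IsHalfSlope τ a w) (z : 𝕜) :
    penalty τ a + 2 * w * (RCLike.re z - a) ≤ penalty τ ‖z‖ := by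
  refine le_trans ?_ (penalty_add_le_of_isHalfSlope hτ hw (norm_nonneg z))
  have := mul_le_mul_of_nonneg_left (RCLike.re_le_norm z) hw.1
  linarith

/-- Jensen's inequality for the penalty and subprobability weights. -/
theorem penalty_le_sum {ι : Type*} {s : Finset ι} {τ b : ℝ} (hτ : 0 ≤ τ)
    {c d : ι → ℝ} (hc : ∀ i ∈ s, 0 ≤ c i) (hc1 : ∑ i ∈ s, c i ≤ 1) (hd : ∀ i ∈ s, 0 ≤ d i)
    (hbd : b ≤ ∑ i ∈ s, c i * d i) : penalty τ b ≤ ∑ i ∈ s, c i * penalty τ (d i) := by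
  have hs := isHalfSlope_max hτ b
  -- The supporting line at `b` has nonpositive value at `0`, so total weight below one does no
  -- harm.
  have h0 := penalty_add_le_of_isHalfSlope hτ hs le_rfl
  rw [penalty_zero hτ] at h0
  have h1 : ∑ i ∈ s, c i * (penalty τ b + 2 * max b τ * (d i - b)) ≤
      ∑ i ∈ s, c i * penalty τ (d i) := Finset.sum_le_sum fun i hi =>
    mul_le_mul_of_nonneg_left (penalty_add_le_of_isHalfSlope hτ hs (hd i hi)) (hc i hi)
  have h2 : ∑ i ∈ s, c i * (penalty τ b + 2 * max b τ * (d i - b)) =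
      (∑ i ∈ s, c i) * (penalty τ b - 2 * max b τ * b) +
        2 * max b τ * ∑ i ∈ s, c i * d i := by
    rw [Finset.sum_mul, Finset.mul_sum, ← Finset.sum_add_distrib]
    exact Finset.sum_congr rfl fun i _ => by ring
  have h3 := mul_le_mul_of_nonneg_left hbd (show 0 ≤ 2 * max b τ by linarith [hs.1])
  nlinarith [mul_nonneg (sub_nonneg.2 hc1)
    (show 0 ≤ -(penalty τ b - 2 * max b τ * b) by linarith)]

theorem shrink_zero {τ q : ℝ} (hτ : 0 ≤ τ) : shrink τ q 0 = 0 := by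
  simp [shrink, hτ]

theorem shrink_le {τ q y : ℝ} (hq : 1 < q) (hy : 0 ≤ y) : shrink τ q y ≤ y :=
  max_le (min_le_left _ _) (div_le_self hy hq.le)

/-- The scalar resolvent: `y = (q - 1) a + w` with `w = shrink τ q y`. For `y ≤ τ`, `a = 0`; for `τ
≤ y ≤ qτ`, `w = τ` and `a ≤ τ`; beyond that, `a = w = y / q`. -/
theorem isHalfSlope_shrink {τ q y : ℝ} (hq : 1 < q) (hy : 0 ≤ y) :
    IsHalfSlope τ ((q - 1)⁻¹ * (y - shrink τ q y)) (shrink τ q y) := by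
  have hq0 : 0 < q := by linarith
  have hq1 : 0 < q - 1 := by linarith
  refine ⟨le_max_of_le_right (by positivity), ?_⟩
  have hyq : y / q ≤ y := div_le_self hy hq.le
  rcases le_total y τ with h | h
  · left
    rw [shrink, min_eq_left h, max_eq_left hyq]
    simp [h]
  · right
    rw [shrink, min_eq_right h]
    rcases le_total τ (y / q) with h' | h'
    · have e : (q - 1)⁻¹ * (y - y / q) = y / q := by field_simp
      rw [max_eq_right h', e, max_eq_left h']
    · rw [max_eq_left h', eq_comm, max_eq_right_iff, inv_mul_le_iff₀ hq1]
      rw [div_le_iff₀ hq0] at h'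
      linarith

/-! ### Diagonal entries in a pair of orthonormal bases -/

theorem rectDiag_eq_sum (𝕜 : Type*) [RCLike 𝕜] (m n : ℕ) (σ : ℕ → ℝ) :
    rectDiag 𝕜 m n σ = ∑ k : Fin (min m n), Matrix.single (k.castLE (min_le_left m n))
      (k.castLE (min_le_right m n)) ((σ k : ℝ) : 𝕜) := by
  ext i j
  rw [Matrix.sum_apply]
  simp only [rectDiag, Matrix.of_apply, Matrix.single_apply, Fin.ext_iff, Fin.val_castLE]
  split_ifs with h
  · rw [Finset.sum_eq_single (⟨i, lt_min i.2 (h ▸ j.2)⟩ : Fin (min m n))]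
    · simp [h]
    · intro k _ hk
      rw [if_neg]
      exact fun h' => hk (Fin.ext h'.1)
    · simp
  · refine (Finset.sum_eq_zero fun k _ => if_neg ?_).symm
    rintro ⟨h1, h2⟩
    exact h (h1.symm.trans h2)

theorem mul_rectDiag_mul_apply {𝕜 : Type*} [RCLike 𝕜] {m n : ℕ} {α β : Type*}
    (P : Matrix α (Fin m) 𝕜) (Q : Matrix (Fin n) β 𝕜) (σ : ℕ → ℝ) (i : α) (j : β) :
    (P * rectDiag 𝕜 m n σ * Q) i j = ∑ k : Fin (min m n),
      P i (k.castLE (min_le_left m n)) * (σ k : 𝕜) * Q (k.castLE (min_le_right m n)) j := by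
  rw [rectDiag_eq_sum, Matrix.mul_sum, Matrix.sum_mul, Matrix.sum_apply]
  refine Finset.sum_congr rfl fun k _ => ?_
  rw [Matrix.mul_apply, Finset.sum_eq_single (k.castLE (min_le_right m n))]
  · rw [Matrix.mul_single_apply_same]
  · intro b _ hb
    rw [Matrix.mul_single_apply_of_ne _ _ _ _ _ hb, zero_mul]
  · simp

/-- The diagonal entries of `Uᴴ B V`. -/
def diagEntry {𝕜 : Type*} [RCLike 𝕜] {m n : ℕ} (U : Matrix (Fin m) (Fin m) 𝕜)
    (V : Matrix (Fin n) (Fin n) 𝕜) (B : Matrix (Fin m) (Fin n) 𝕜) (k : Fin (min m n)) : 𝕜 :=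
  (U.conjTranspose * B * V) (k.castLE (min_le_left m n)) (k.castLE (min_le_right m n))

theorem diagEntry_self {𝕜 : Type*} [RCLike 𝕜] {m n : ℕ} {U : Matrix (Fin m) (Fin m) 𝕜}
    {V : Matrix (Fin n) (Fin n) 𝕜} (hU : U ∈ Matrix.unitaryGroup (Fin m) 𝕜)
    (hV : V ∈ Matrix.unitaryGroup (Fin n) 𝕜) (a : ℕ → ℝ) (k : Fin (min m n)) :
    diagEntry U V (U * rectDiag 𝕜 m n a * V.conjTranspose) k = (a k : 𝕜) := by
  have u1 : U.conjTranspose * U = 1 := Matrix.mem_unitaryGroup_iff'.1 hU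
  have v1 : V.conjTranspose * V = 1 := Matrix.mem_unitaryGroup_iff'.1 hV
  have e : U.conjTranspose * (U * rectDiag 𝕜 m n a * V.conjTranspose) * V = rectDiag 𝕜 m n a := by
    rw [Matrix.mul_assoc, Matrix.mul_assoc (U * _), v1, Matrix.mul_one, ← Matrix.mul_assoc, u1,
      Matrix.one_mul]
  rw [diagEntry, e]
  simp [rectDiag]

theorem inner_mul_rectDiag_mul {𝕜 : Type*} [RCLike 𝕜] {m n : ℕ} (U : Matrix (Fin m) (Fin m) 𝕜)
    (V : Matrix (Fin n) (Fin n) 𝕜) (w : ℕ → ℝ) (B : Matrix (Fin m) (Fin n) 𝕜) :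
    inner 𝕜 (U * rectDiag 𝕜 m n w * V.conjTranspose) B =
      ∑ k : Fin (min m n), (w k : 𝕜) * diagEntry U V B k := by
  change ((U * rectDiag 𝕜 m n w * V.conjTranspose).conjTranspose * B).trace = _
  rw [Matrix.conjTranspose_mul, Matrix.conjTranspose_mul, Matrix.conjTranspose_conjTranspose,
    Matrix.mul_assoc, Matrix.trace_mul_comm, rectDiag_eq_sum, Matrix.conjTranspose_sum,
    Matrix.mul_assoc, Matrix.mul_assoc, Matrix.sum_mul, Matrix.trace_sum]
  refine Finset.sum_congr rfl fun k _ => ?_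
  rw [Matrix.conjTranspose_single, Matrix.trace_single_mul, RCLike.star_def, RCLike.conj_ofReal,
    ← Matrix.mul_assoc]
  rfl

theorem re_inner_mul_rectDiag_mul {𝕜 : Type*} [RCLike 𝕜] {m n : ℕ}
    (U : Matrix (Fin m) (Fin m) 𝕜) (V : Matrix (Fin n) (Fin n) 𝕜) (w : ℕ → ℝ)
    (B : Matrix (Fin m) (Fin n) 𝕜) :
    RCLike.re (inner 𝕜 (U * rectDiag 𝕜 m n w * V.conjTranspose) B) =
      ∑ k : Fin (min m n), w k * RCLike.re (diagEntry U V B k) := by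
  rw [inner_mul_rectDiag_mul, map_sum]
  exact Finset.sum_congr rfl fun k _ => RCLike.re_ofReal_mul _ _

theorem singularValue_nonneg {𝕜 : Type*} [RCLike 𝕜] {m n : ℕ} (A : Matrix (Fin m) (Fin n) 𝕜)
    (j : ℕ) : 0 ≤ singularValue A j :=
  (Matrix.toEuclideanLin A).singularValues_nonneg j

theorem norm_sq_eq_sum_singularValue {𝕜 : Type*} [RCLike 𝕜] {m n : ℕ}
    (A : Matrix (Fin m) (Fin n) 𝕜) :
    ‖A‖ ^ 2 = ∑ k : Fin (min m n), singularValue A k ^ 2 := by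
  obtain ⟨U, V, hU, hV, hA⟩ := exists_isSVD A
  rw [norm_sq_eq_re_inner (𝕜 := 𝕜) A]
  nth_rewrite 1 [hA]
  rw [re_inner_mul_rectDiag_mul]
  refine Finset.sum_congr rfl fun k _ => ?_
  nth_rewrite 2 [hA]
  rw [diagEntry_self hU hV, RCLike.ofReal_re, sq]

/-! ### The convex part of the objective -/

/-- The convex function `A ↦ R_τ(A) + ‖A‖²`. -/
noncomputable def convexReg {𝕜 : Type*} [RCLike 𝕜] {m n : ℕ} (τ : ℝ)
    (A : Matrix (Fin m) (Fin n) 𝕜) : ℝ :=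
  rankReg τ A + ‖A‖ ^ 2

theorem convexReg_eq_sum {𝕜 : Type*} [RCLike 𝕜] {m n : ℕ} (τ : ℝ)
    (A : Matrix (Fin m) (Fin n) 𝕜) :
    convexReg τ A = ∑ k : Fin (min m n), penalty τ (singularValue A k) := by
  rw [convexReg, norm_sq_eq_sum_singularValue, rankReg, Finset.sum_range,
    ← Finset.sum_add_distrib]
  rfl

/-- Rows of a unitary matrix are unit vectors; cutting them to `l` entries leaves an inequality,
which is why the weights below are only substochastic. -/
theorem sum_norm_sq_row_le {𝕜 : Type*} [RCLike 𝕜] {m l : ℕ} {P : Matrix (Fin m) (Fin m) 𝕜}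
    (hP : P ∈ Matrix.unitaryGroup (Fin m) 𝕜) (h : l ≤ m) (i : Fin m) :
    ∑ k : Fin l, ‖P i (k.castLE h)‖ ^ 2 ≤ 1 := by
  have h1 : ∑ k, ‖P i k‖ ^ 2 = 1 := by
    have h2 : (P * P.conjTranspose) i i = 1 := by
      rw [show P * P.conjTranspose = 1 from Matrix.mem_unitaryGroup_iff.1 hP, Matrix.one_apply_eq]
    simp only [Matrix.mul_apply, Matrix.conjTranspose_apply, RCLike.star_def, RCLike.mul_conj] at h2
    exact_mod_cast h2
  rw [← h1]
  refine (Finset.sum_map Finset.univ (Fin.castLEEmb h) (fun k => ‖P i k‖ ^ 2)).symm.le.trans ?_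
  exact Finset.sum_le_sum_of_subset_of_nonneg (Finset.subset_univ _) fun _ _ _ => by positivity

theorem sum_norm_sq_col_le {𝕜 : Type*} [RCLike 𝕜] {m l : ℕ} {P : Matrix (Fin m) (Fin m) 𝕜}
    (hP : P ∈ Matrix.unitaryGroup (Fin m) 𝕜) (h : l ≤ m) (i : Fin m) :
    ∑ k : Fin l, ‖P (k.castLE h) i‖ ^ 2 ≤ 1 := by
  have := sum_norm_sq_row_le (Unitary.star_mem hP) h i
  simpa [Matrix.star_apply] using this

/-- The sum of the penalties of the diagonal entries in any pair of orthonormal bases is at most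
the sum of the penalties of the diagonal coefficients. -/
theorem sum_penalty_diagEntry_le {𝕜 : Type*} [RCLike 𝕜] {m n : ℕ} {τ : ℝ} (hτ : 0 ≤ τ)
    {U U' : Matrix (Fin m) (Fin m) 𝕜} {V V' : Matrix (Fin n) (Fin n) 𝕜}
    (hU : U ∈ Matrix.unitaryGroup (Fin m) 𝕜) (hV : V ∈ Matrix.unitaryGroup (Fin n) 𝕜)
    (hU' : U' ∈ Matrix.unitaryGroup (Fin m) 𝕜) (hV' : V' ∈ Matrix.unitaryGroup (Fin n) 𝕜)
    {a : ℕ → ℝ} (ha : ∀ k, 0 ≤ a k) :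
    ∑ k, penalty τ ‖diagEntry U V (U' * rectDiag 𝕜 m n a * V'.conjTranspose) k‖ ≤
      ∑ k : Fin (min m n), penalty τ (a k) := by
  set P := U.conjTranspose * U'
  set Q := V'.conjTranspose * V
  have hPu : P ∈ Matrix.unitaryGroup (Fin m) 𝕜 := mul_mem (Unitary.star_mem hU) hU'
  have hQu : Q ∈ Matrix.unitaryGroup (Fin n) 𝕜 := mul_mem (Unitary.star_mem hV') hV
  let p : Fin (min m n) → Fin (min m n) → 𝕜 := fun i k =>
    P (i.castLE (min_le_left m n)) (k.castLE (min_le_left m n))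
  let r : Fin (min m n) → Fin (min m n) → 𝕜 := fun k i =>
    Q (k.castLE (min_le_right m n)) (i.castLE (min_le_right m n))
  -- By the AM–GM inequality `‖p i k‖ * ‖r k i‖ ≤ c i k`. Row sums at most one allow Jensen; column
  -- sums at most one then remove the weights.
  let c : Fin (min m n) → Fin (min m n) → ℝ := fun i k => (‖p i k‖ ^ 2 + ‖r k i‖ ^ 2) / 2
  have hentry : ∀ i, diagEntry U V (U' * rectDiag 𝕜 m n a * V'.conjTranspose) i =
      ∑ k, p i k * (a k : 𝕜) * r k i := by
    intro i
    rw [← mul_rectDiag_mul_apply, diagEntry]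
    simp only [Matrix.mul_assoc]
  have hc0 : ∀ i k, 0 ≤ c i k := fun i k => by positivity
  have hrow : ∀ i, ∑ k, c i k ≤ 1 := by
    intro i
    have h1 := sum_norm_sq_row_le hPu (min_le_left m n) (i.castLE (min_le_left m n))
    have h2 := sum_norm_sq_col_le hQu (min_le_right m n) (i.castLE (min_le_right m n))
    simp only [c]
    rw [← Finset.sum_div, Finset.sum_add_distrib]
    simp only [p, r]
    linarith
  have hcol : ∀ k, ∑ i, c i k ≤ 1 := by
    intro k
    have h1 := sum_norm_sq_col_le hPu (min_le_left m n) (k.castLE (min_le_left m n))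
    have h2 := sum_norm_sq_row_le hQu (min_le_right m n) (k.castLE (min_le_right m n))
    simp only [c]
    rw [← Finset.sum_div, Finset.sum_add_distrib]
    simp only [p, r]
    linarith
  have hpen : ∀ k : ℕ, 0 ≤ penalty τ (a k) := by
    intro k
    have := penalty_add_le_of_isHalfSlope hτ (a := 0) (w := 0) ⟨le_rfl, Or.inl ⟨rfl, hτ⟩⟩ (ha k)
    simpa [penalty_zero hτ] using this
  calc ∑ i, penalty τ ‖diagEntry U V (U' * rectDiag 𝕜 m n a * V'.conjTranspose) i‖
      ≤ ∑ i, ∑ k, c i k * penalty τ (a k) := by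
        refine Finset.sum_le_sum fun i _ => ?_
        refine penalty_le_sum (d := fun k : Fin (min m n) => a k) hτ (fun k _ => hc0 i k) (hrow i)
          (fun k _ => ha k) ?_
        rw [hentry]
        refine (norm_sum_le _ _).trans (Finset.sum_le_sum fun k _ => ?_)
        rw [norm_mul, norm_mul, RCLike.norm_ofReal, abs_of_nonneg (ha k), mul_right_comm]
        refine mul_le_mul_of_nonneg_right ?_ (ha k)
        simp only [c]
        nlinarith [sq_nonneg (‖p i k‖ - ‖r k i‖)]
    _ = ∑ k, (∑ i, c i k) * penalty τ (a k) := by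
        rw [Finset.sum_comm]
        exact Finset.sum_congr rfl fun k _ => (Finset.sum_mul _ _ _).symm
    _ ≤ ∑ k : Fin (min m n), penalty τ (a k) :=
        Finset.sum_le_sum fun k _ => mul_le_of_le_one_left (hpen k) (hcol k)

theorem sum_penalty_diagEntry_le_convexReg {𝕜 : Type*} [RCLike 𝕜] {m n : ℕ} {τ : ℝ}
    (hτ : 0 ≤ τ) {U : Matrix (Fin m) (Fin m) 𝕜} {V : Matrix (Fin n) (Fin n) 𝕜}
    (hU : U ∈ Matrix.unitaryGroup (Fin m) 𝕜) (hV : V ∈ Matrix.unitaryGroup (Fin n) 𝕜)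
    (A : Matrix (Fin m) (Fin n) 𝕜) :
    ∑ k, penalty τ ‖diagEntry U V A k‖ ≤ convexReg τ A := by
  obtain ⟨U', V', hU', hV', hA⟩ := exists_isSVD A
  rw [convexReg_eq_sum]
  nth_rewrite 1 [hA]
  exact sum_penalty_diagEntry_le hτ hU hV hU' hV' fun k => singularValue_nonneg A k

/-- The coefficients `a` need not be decreasing, so they are not compared with the singular values
one by one. Instead the singular bases of the product serve as the test bases in
`sum_penalty_diagEntry_le`. -/
theorem convexReg_mul_rectDiag_mul_le {𝕜 : Type*} [RCLike 𝕜] {m n : ℕ} {τ : ℝ}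
    (hτ : 0 ≤ τ) {U : Matrix (Fin m) (Fin m) 𝕜} {V : Matrix (Fin n) (Fin n) 𝕜}
    (hU : U ∈ Matrix.unitaryGroup (Fin m) 𝕜) (hV : V ∈ Matrix.unitaryGroup (Fin n) 𝕜)
    {a : ℕ → ℝ} (ha : ∀ k, 0 ≤ a k) :
    convexReg τ (U * rectDiag 𝕜 m n a * V.conjTranspose) ≤
      ∑ k : Fin (min m n), penalty τ (a k) := by
  set A := U * rectDiag 𝕜 m n a * V.conjTranspose with hAdef
  obtain ⟨U', V', hU', hV', hA⟩ := exists_isSVD A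
  refine le_trans (le_of_eq ?_) (sum_penalty_diagEntry_le hτ hU' hV' hU hV ha)
  rw [convexReg_eq_sum, ← hAdef]
  refine Finset.sum_congr rfl fun k _ => ?_
  nth_rewrite 2 [hA]
  rw [diagEntry_self hU' hV', RCLike.norm_ofReal, abs_of_nonneg (singularValue_nonneg A k)]

/-- `2 W` is a subgradient of `A ↦ R_τ(A) + ‖A‖²` at `A`. -/
def IsHalfSubgradient {𝕜 : Type*} [RCLike 𝕜] {m n : ℕ} (τ : ℝ)
    (W A : Matrix (Fin m) (Fin n) 𝕜) : Prop :=
  ∀ B, convexReg τ A + 2 * RCLike.re (inner 𝕜 W (B - A)) ≤ convexReg τ B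

/-- The inner product with a matrix diagonal in the bases `U`, `V` sees only the diagonal entries
there, so the claim reduces to the scalar inequality `penalty_add_re_le` for each entry. -/
theorem isHalfSubgradient_of_diag {𝕜 : Type*} [RCLike 𝕜] {m n : ℕ} {τ : ℝ}
    (hτ : 0 ≤ τ) {U : Matrix (Fin m) (Fin m) 𝕜} {V : Matrix (Fin n) (Fin n) 𝕜}
    (hU : U ∈ Matrix.unitaryGroup (Fin m) 𝕜) (hV : V ∈ Matrix.unitaryGroup (Fin n) 𝕜)
    {a w : ℕ → ℝ} (ha : ∀ k, 0 ≤ a k) (hw : ∀ k, IsHalfSlope τ (a k) (w k)) :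
    IsHalfSubgradient τ (U * rectDiag 𝕜 m n w * V.conjTranspose)
      (U * rectDiag 𝕜 m n a * V.conjTranspose) := by
  intro B
  have h1 := convexReg_mul_rectDiag_mul_le hτ hU hV ha
  have h2 := sum_penalty_diagEntry_le_convexReg hτ hU hV B
  have h3 : ∑ k : Fin (min m n),
      (penalty τ (a k) + 2 * w k * (RCLike.re (diagEntry U V B k) - a k)) ≤
      ∑ k, penalty τ ‖diagEntry U V B k‖ :=
    Finset.sum_le_sum fun k _ => penalty_add_re_le hτ (hw k) _
  have h4 : RCLike.re (inner 𝕜 (U * rectDiag 𝕜 m n w * V.conjTranspose)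
      (B - U * rectDiag 𝕜 m n a * V.conjTranspose)) =
      ∑ k : Fin (min m n), w k * (RCLike.re (diagEntry U V B k) - a k) := by
    rw [inner_sub_right, map_sub, re_inner_mul_rectDiag_mul, re_inner_mul_rectDiag_mul,
      ← Finset.sum_sub_distrib]
    refine Finset.sum_congr rfl fun k _ => ?_
    rw [diagEntry_self hU hV, RCLike.ofReal_re]
    ring
  have h5 : ∑ k : Fin (min m n),
      (penalty τ (a k) + 2 * w k * (RCLike.re (diagEntry U V B k) - a k)) =
      ∑ k : Fin (min m n), penalty τ (a k) +
        2 * ∑ k : Fin (min m n), w k * (RCLike.re (diagEntry U V B k) - a k) := by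
    rw [Finset.mul_sum, ← Finset.sum_add_distrib]
    exact Finset.sum_congr rfl fun k _ => by ring
  rw [h4]
  linarith

theorem exists_isHalfSubgradient {𝕜 : Type*} [RCLike 𝕜] {m n : ℕ} {τ : ℝ} (hτ : 0 ≤ τ)
    (A : Matrix (Fin m) (Fin n) 𝕜) : ∃ W, IsHalfSubgradient τ W A := by
  obtain ⟨U, V, hU, hV, hA⟩ := exists_isSVD A
  have h := isHalfSubgradient_of_diag hτ hU hV (singularValue_nonneg A)
    fun k => isHalfSlope_max hτ (singularValue A k)
  rw [← hA] at h
  exact ⟨_, h⟩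

/-- Both matrices are diagonal in the singular bases of `Y`, where `isHalfSlope_shrink` applies
entrywise. -/
theorem isHalfSubgradient_svCalculus_shrink {𝕜 : Type*} [RCLike 𝕜] {m n : ℕ} {τ q : ℝ}
    (hτ : 0 ≤ τ) (hq : 1 < q) (Y : Matrix (Fin m) (Fin n) 𝕜) :
    IsHalfSubgradient τ (svCalculus (shrink τ q) Y)
      ((q - 1)⁻¹ • (Y - svCalculus (shrink τ q) Y)) := by
  obtain ⟨U, V, hY⟩ := exists_isSVD Y
  have hs := svCalculus_eq (shrink_zero (q := q) hτ) hY
  have hq1 : 0 < q - 1 := by linarith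
  have e : (q - 1)⁻¹ • (Y - svCalculus (shrink τ q) Y) = U * rectDiag 𝕜 m n (fun j =>
      (q - 1)⁻¹ * (singularValue Y j - shrink τ q (singularValue Y j))) * V.conjTranspose := by
    have e1 : rectDiag 𝕜 m n (fun j =>
        (q - 1)⁻¹ * (singularValue Y j - shrink τ q (singularValue Y j))) =
        (q - 1)⁻¹ • (rectDiag 𝕜 m n (singularValue Y) -
          rectDiag 𝕜 m n (fun j => shrink τ q (singularValue Y j))) := by
      ext i j
      simp only [rectDiag, Matrix.of_apply, Matrix.smul_apply, Matrix.sub_apply]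
      split_ifs <;> simp [RCLike.real_smul_eq_coe_mul]
    rw [e1, Matrix.mul_smul, Matrix.smul_mul, Matrix.mul_sub, Matrix.sub_mul, ← hY.eq_mul, ← hs]
  rw [e, hs]
  exact isHalfSubgradient_of_diag hτ hY.left_unitary hY.right_unitary
    (fun k => mul_nonneg (inv_nonneg.2 hq1.le)
      (sub_nonneg.2 (shrink_le hq (singularValue_nonneg Y k))))
    fun k => isHalfSlope_shrink hq (singularValue_nonneg Y k)

theorem IsHalfSubgradient.monotone {𝕜 : Type*} [RCLike 𝕜] {m n : ℕ} {τ : ℝ}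
    {W A W' A' : Matrix (Fin m) (Fin n) 𝕜} (h : IsHalfSubgradient τ W A)
    (h' : IsHalfSubgradient τ W' A') : 0 ≤ RCLike.re (inner 𝕜 (W - W') (A - A')) := by
  have h1 := h A'
  have h2 := h' A
  have h3 : inner 𝕜 (W - W') (A - A') = -inner 𝕜 W (A' - A) - inner 𝕜 W' (A - A') := by
    rw [inner_sub_left, ← inner_neg_right, neg_sub]
  rw [h3, map_sub, map_neg]
  linarith

/-- The pairs of a matrix and half a subgradient there are the fixed points of the singular value
functional calculus with `shrink τ q`. -/
theorem isHalfSubgradient_iff {𝕜 : Type*} [RCLike 𝕜] {m n : ℕ} {τ q : ℝ}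
    (hτ : 0 ≤ τ) (hq : 1 < q) (W A : Matrix (Fin m) (Fin n) 𝕜) :
    IsHalfSubgradient τ W A ↔ svCalculus (shrink τ q) ((q - 1) • A + W) = W := by
  have hq1 : 0 < q - 1 := by linarith
  have h' := isHalfSubgradient_svCalculus_shrink hτ hq ((q - 1) • A + W)
  set W' := svCalculus (shrink τ q) ((q - 1) • A + W)
  refine ⟨fun h => ?_, fun h => ?_⟩
  -- `W` and `W'` are half subgradients at points whose difference is `-(q - 1)⁻¹ • (W - W')`, so
  -- monotonicity forces `W = W'`.
  · have h1 := h.monotone h'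
    have e : A - (q - 1)⁻¹ • ((q - 1) • A + W - W') = -((q - 1)⁻¹ • (W - W')) := by
      rw [add_sub_assoc, smul_add, smul_smul, inv_mul_cancel₀ hq1.ne', one_smul]
      abel
    rw [e, inner_neg_right, map_neg, RCLike.real_smul_eq_coe_smul (K := 𝕜), inner_smul_right,
      RCLike.re_ofReal_mul, ← norm_sq_eq_re_inner] at h1
    have h2 : 0 < (q - 1)⁻¹ := inv_pos.2 hq1
    have h3 : ‖W - W'‖ ^ 2 ≤ 0 := by
      by_contra hn
      have := mul_pos h2 (not_le.1 hn)
      linarith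
    have h4 : ‖W - W'‖ = 0 := by
      have := sq_nonneg ‖W - W'‖
      exact pow_eq_zero_iff two_ne_zero |>.1 (le_antisymm h3 this)
    exact (sub_eq_zero.1 (norm_eq_zero.1 h4)).symm
  · rw [h, add_sub_cancel_right, smul_smul, inv_mul_cancel₀ hq1.ne', one_smul] at h'
    exact h'

theorem convexOn_convexReg {𝕜 : Type*} [RCLike 𝕜] {m n : ℕ} {τ : ℝ} (hτ : 0 ≤ τ) :
    ConvexOn ℝ Set.univ (convexReg τ : Matrix (Fin m) (Fin n) 𝕜 → ℝ) := by
  refine convexOn_of_supporting fun A => ?_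
  obtain ⟨W, hW⟩ := exists_isHalfSubgradient hτ A
  exact ⟨(2 : ℝ) • (RCLike.reLm ∘ₗ ((innerₛₗ 𝕜 W).restrictScalars ℝ)), fun B => hW B⟩

/-! ### Stationary points and fixed points -/

/-- A subgradient along a subspace is the projection of a subgradient on the whole space. -/
theorem exists_isHalfSubgradient_of_subspace {𝕜 : Type*} [RCLike 𝕜] {m n : ℕ} {τ : ℝ}
    (hτ : 0 ≤ τ) (H : Submodule 𝕜 (Matrix (Fin m) (Fin n) 𝕜)) (A B : H)
    (hB : ∀ X : H, convexReg τ (A : Matrix (Fin m) (Fin n) 𝕜) + 2 * RCLike.re (inner 𝕜 B (X - A)) ≤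
      convexReg τ (X : Matrix (Fin m) (Fin n) 𝕜)) :
    ∃ W, IsHalfSubgradient τ W (A : Matrix (Fin m) (Fin n) 𝕜) ∧
      H.orthogonalProjectionOnto W = B := by
  let f : Matrix (Fin m) (Fin n) 𝕜 →ₗ.[ℝ] ℝ :=
    ⟨H.restrictScalars ℝ, ((2 : ℝ) • (RCLike.reLm ∘ₗ
      ((innerₛₗ 𝕜 (B : Matrix (Fin m) (Fin n) 𝕜)).restrictScalars ℝ))).domRestrict _⟩
  obtain ⟨l, hl1, hl2⟩ := exists_subgradient_extension (convexOn_convexReg hτ)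
    (A : Matrix (Fin m) (Fin n) 𝕜) f (fun d => by
      have h := hB (A + ⟨d.1, d.2⟩)
      rw [add_sub_cancel_left] at h
      exact h)
  -- Riesz vector of the `𝕜`-linear functional with real part `l / 2`.
  let W : Matrix (Fin m) (Fin n) 𝕜 := (InnerProductSpace.toDual 𝕜 _).symm
    (LinearMap.toContinuousLinearMap (Module.Dual.extendRCLike (𝕜 := 𝕜) ((2 : ℝ)⁻¹ • l)))
  have hW : ∀ D, 2 * RCLike.re (inner 𝕜 W D) = l D := by
    intro D
    have : inner 𝕜 W D = Module.Dual.extendRCLike (𝕜 := 𝕜) ((2 : ℝ)⁻¹ • l) D :=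
      InnerProductSpace.toDual_symm_apply
    rw [this, Module.Dual.re_extendRCLike_apply, LinearMap.smul_apply, smul_eq_mul]
    ring
  refine ⟨W, fun X => ?_, ?_⟩
  · have h := hl2 (X - A)
    rwa [add_sub_cancel, ← hW] at h
  · have h1 : ∀ D : H, RCLike.re (inner 𝕜 (H.orthogonalProjectionOnto W - B) D) = 0 := by
      intro D
      have h2 : l D = 2 * RCLike.re (inner 𝕜 (B : Matrix (Fin m) (Fin n) 𝕜) D) := hl1 ⟨D, D.2⟩
      rw [inner_sub_left, map_sub, Submodule.inner_orthogonalProjectionOnto_eq_of_mem_right,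
        Submodule.coe_inner]
      linarith [hW D]
    have h2 := h1 (H.orthogonalProjectionOnto W - B)
    rw [← norm_sq_eq_re_inner] at h2
    exact sub_eq_zero.1 (norm_eq_zero.1 (pow_eq_zero_iff two_ne_zero |>.1 h2))

theorem coe_real_smul {𝕜 : Type*} [RCLike 𝕜] {m n : ℕ}
    {H : Submodule 𝕜 (Matrix (Fin m) (Fin n) 𝕜)} (q : ℝ) (x : H) : q • x = (q : 𝕜) • x :=
  Subtype.ext (RCLike.real_smul_eq_coe_smul (K := 𝕜) q (x : Matrix (Fin m) (Fin n) 𝕜))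

theorem re_inner_ofReal_smul_left {𝕜 : Type*} [RCLike 𝕜] {m n : ℕ}
    {H : Submodule 𝕜 (Matrix (Fin m) (Fin n) 𝕜)} (q : ℝ) (x y : H) :
    RCLike.re (inner 𝕜 ((q : 𝕜) • x) y) = q * RCLike.re (inner 𝕜 x y) := by
  have h : inner 𝕜 ((q : 𝕜) • x) y = _ := inner_smul_left (𝕜 := 𝕜) (E := H) x y (q : 𝕜)
  rw [h, RCLike.conj_ofReal, RCLike.re_ofReal_mul]

theorem objective_eq {𝕜 : Type*} [RCLike 𝕜] {m n : ℕ}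
    {H : Submodule 𝕜 (Matrix (Fin m) (Fin n) 𝕜)} {V : Type*} [NormedAddCommGroup V]
    [InnerProductSpace 𝕜 V] (M : H →ₗ[𝕜] V) (h : V) {τ q : ℝ} (A : H) :
    objective M h τ q A =
      convexReg τ (A : Matrix (Fin m) (Fin n) 𝕜) + (q * ‖M A - h‖ ^ 2 - ‖A‖ ^ 2) := by
  rw [objective, convexReg, Submodule.coe_norm]
  ring

section Objective

variable {𝕜 : Type*} [RCLike 𝕜] {m n : ℕ} {H : Submodule 𝕜 (Matrix (Fin m) (Fin n) 𝕜)}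
  {V : Type*} [NormedAddCommGroup V] [InnerProductSpace 𝕜 V] [FiniteDimensional 𝕜 V]
  (M : H →ₗ[𝕜] V) (h : V) {τ q : ℝ}

/-- Half the negative gradient of the smooth part `A ↦ q ‖M A - h‖² - ‖A‖²` of the
objective. -/
noncomputable def halfNegGrad (q : ℝ) (A : H) : H := q • gradStep M h A - (q - 1) • A

/-- The expansion is exact because the function is quadratic; its remainder is the quadratic form of
`qM*M - I`. -/
theorem smooth_part_expansion (A X : H) :
    q * ‖M X - h‖ ^ 2 - ‖X‖ ^ 2 = q * ‖M A - h‖ ^ 2 - ‖A‖ ^ 2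
      - 2 * RCLike.re (inner 𝕜 (halfNegGrad M h q A) (X - A))
      + q * ‖M (X - A)‖ ^ 2 - ‖X - A‖ ^ 2 := by
  have e1 : M X - h = M (X - A) + (M A - h) := by rw [map_sub]; abel
  have e2 : ‖X‖ ^ 2 = ‖(X - A) + A‖ ^ 2 := by rw [sub_add_cancel]
  have e3 : halfNegGrad M h q A = A + (q : 𝕜) • LinearMap.adjoint M (h - M A) := by
    rw [halfNegGrad, gradStep, coe_real_smul, coe_real_smul]
    push_cast
    module
  rw [e1, e2, norm_add_sq (𝕜 := 𝕜), norm_add_sq (𝕜 := 𝕜), e3, inner_add_left, map_add,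
    re_inner_ofReal_smul_left, LinearMap.adjoint_inner_left,
    ← neg_sub (M A) h, inner_neg_left, map_neg, inner_re_symm (𝕜 := 𝕜) (M (X - A)),
    inner_re_symm (𝕜 := 𝕜) (X - A)]
  ring

theorem objective_ge_of_isHalfSubgradient {A : H} {W : Matrix (Fin m) (Fin n) 𝕜}
    (hW : IsHalfSubgradient τ W (A : Matrix (Fin m) (Fin n) 𝕜)) (X : H) :
    objective M h τ q A +
      2 * RCLike.re (inner 𝕜 (H.orthogonalProjectionOnto W - halfNegGrad M h q A) (X - A)) +
      (q * ‖M (X - A)‖ ^ 2 - ‖X - A‖ ^ 2) ≤ objective M h τ q X := by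
  have h1 := hW X
  rw [objective_eq, objective_eq, smooth_part_expansion M h A X, inner_sub_left, map_sub,
    Submodule.inner_orthogonalProjectionOnto_eq_of_mem_right]
  rw [← Submodule.coe_sub] at h1
  linarith

/-- Once `W' = W`, the equation `A' = A` is the formula for `P_H W`. That formula turns the argument
of `𝔖_s` into `(q - 1) A + W`, so `W' = W` becomes the resolvent equation. -/
theorem isFixedPt_iff (hτ : 0 ≤ τ) (hq : 1 < q) (W : Matrix (Fin m) (Fin n) 𝕜) (A : H) :
    Function.IsFixedPt (fixedPointMap M h τ q) (W, A) ↔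
      IsHalfSubgradient τ W (A : Matrix (Fin m) (Fin n) 𝕜) ∧
        H.orthogonalProjectionOnto W = halfNegGrad M h q A := by
  have hq1 : q - 1 ≠ 0 := by linarith
  have key : H.orthogonalProjectionOnto W = halfNegGrad M h q A →
      q • (gradStep M h A : Matrix (Fin m) (Fin n) 𝕜) + Hᗮ.starProjection W =
        (q - 1) • (A : Matrix (Fin m) (Fin n) 𝕜) + W := by
    intro hP
    have h1 : (H.orthogonalProjectionOnto W : Matrix (Fin m) (Fin n) 𝕜) =
        q • (gradStep M h A : Matrix (Fin m) (Fin n) 𝕜) -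
          (q - 1) • (A : Matrix (Fin m) (Fin n) 𝕜) := by
      rw [hP]; rfl
    have h2 : Hᗮ.starProjection W =
        W - (H.orthogonalProjectionOnto W : Matrix (Fin m) (Fin n) 𝕜) := by
      rw [Submodule.starProjection_orthogonal']
      rfl
    rw [h2, h1]
    abel
  have hsnd : (q - 1)⁻¹ • (q • gradStep M h A - H.orthogonalProjectionOnto W) = A ↔
      H.orthogonalProjectionOnto W = halfNegGrad M h q A := by
    rw [halfNegGrad, inv_smul_eq_iff₀ hq1, sub_eq_iff_eq_add, eq_sub_iff_add_eq, eq_comm, add_comm]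
  rw [Function.IsFixedPt, fixedPointMap, Prod.mk.injEq, isHalfSubgradient_iff hτ hq]
  constructor
  · rintro ⟨h1, h2⟩
    dsimp only at h1 h2
    rw [h1] at h2
    have h3 := hsnd.1 h2
    rw [nextW, key h3] at h1
    exact ⟨h1, h3⟩
  · rintro ⟨h1, h3⟩
    have h2 : nextW M h τ q W A = W := by rw [nextW, key h3, h1]
    refine ⟨h2, ?_⟩
    dsimp only
    rw [h2]
    exact hsnd.2 h3

/-- Stationarity is applied at `A + t • (X - A)` for small `t`; convexity of `convexReg` along the
segment makes the local inequality global after division by `t`. -/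
theorem subgradient_of_isStationaryPoint (hτ : 0 ≤ τ) (hq : 0 ≤ q) {A : H}
    (hA : IsStationaryPoint 𝕜 (objective M h τ q) A) (X : H) :
    convexReg τ (A : Matrix (Fin m) (Fin n) 𝕜) +
      2 * RCLike.re (inner 𝕜 (halfNegGrad M h q A) (X - A)) ≤
      convexReg τ (X : Matrix (Fin m) (Fin n) 𝕜) := by
  set S := 2 * RCLike.re (inner 𝕜 (halfNegGrad M h q A) (X - A)) with hS
  set c := q * ‖M (X - A)‖ ^ 2 with hc
  have hc0 : 0 ≤ c := by positivity
  refine le_of_forall_pos_le_add fun δ hδ => ?_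
  set r := ‖X - A‖ with hr
  have hr0 : 0 ≤ r := norm_nonneg _
  -- Half of `δ` absorbs the error `ε * r`, the other half the second-order term `t * c`; the added
  -- ones avoid division by zero.
  have hε : 0 < δ / (2 * (r + 1)) := by positivity
  have hlim : Filter.Tendsto (fun t : ℝ => A + t • (X - A)) (𝓝[>] 0) (𝓝 A) := by
    have : Continuous fun t : ℝ => A + t • (X - A) :=
      continuous_induced_rng.2 (show Continuous fun t : ℝ => (A : Matrix (Fin m) (Fin n) 𝕜) +
        t • ((X : Matrix (Fin m) (Fin n) 𝕜) - (A : Matrix (Fin m) (Fin n) 𝕜)) by fun_prop)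
    have h0 := this.tendsto 0
    rw [zero_smul, add_zero] at h0
    exact h0.mono_left nhdsWithin_le_nhds
  have hsmall : ∀ᶠ t : ℝ in 𝓝[>] 0, t < min 1 (δ / (2 * (c + 1))) :=
    (eventually_lt_nhds (by positivity)).filter_mono nhdsWithin_le_nhds
  obtain ⟨t, hst, htlt, ht0⟩ := ((hlim.eventually (hA _ hε)).and
    (hsmall.and self_mem_nhdsWithin)).exists
  have ht0 : (0 : ℝ) < t := ht0
  have ht1 : t < 1 := htlt.trans_le (min_le_left _ _)
  have htc : t * (c + 1) < δ / 2 := by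
    have := htlt.trans_le (min_le_right _ _)
    rw [lt_div_iff₀ (by positivity)] at this
    linarith
  have hεr : δ / (2 * (r + 1)) * r ≤ δ / 2 := by
    rw [div_mul_eq_mul_div, div_le_iff₀ (by positivity)]
    nlinarith
  have hnorm : ‖t • (X - A)‖ = t * r := by rw [norm_smul, Real.norm_of_nonneg ht0.le]
  have hMt : ‖M (t • (X - A))‖ ^ 2 = t ^ 2 * ‖M (X - A)‖ ^ 2 := by
    rw [coe_real_smul, map_smul, norm_smul, RCLike.norm_ofReal, abs_of_pos ht0, mul_pow]
  have hinner : RCLike.re (inner 𝕜 (halfNegGrad M h q A) (t • (X - A))) =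
      t * RCLike.re (inner 𝕜 (halfNegGrad M h q A) (X - A)) := by
    rw [inner_re_symm, coe_real_smul, re_inner_ofReal_smul_left, inner_re_symm]
  have hconv := (convexOn_convexReg hτ).2 (Set.mem_univ (A : Matrix (Fin m) (Fin n) 𝕜))
    (Set.mem_univ (X : Matrix (Fin m) (Fin n) 𝕜)) (sub_nonneg.2 ht1.le) ht0.le
    (sub_add_cancel 1 t)
  have hpt : (1 - t) • (A : Matrix (Fin m) (Fin n) 𝕜) + t • (X : Matrix (Fin m) (Fin n) 𝕜) =
      ((A + t • (X - A) : H) : Matrix (Fin m) (Fin n) 𝕜) := by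
    change _ = (A : Matrix (Fin m) (Fin n) 𝕜) +
      t • ((X : Matrix (Fin m) (Fin n) 𝕜) - (A : Matrix (Fin m) (Fin n) 𝕜))
    module
  rw [hpt, smul_eq_mul, smul_eq_mul] at hconv
  rw [inner_zero_left, map_zero, objective_eq, objective_eq,
    smooth_part_expansion M h A (A + t • (X - A)), add_sub_cancel_left, hnorm, hMt, hinner] at hst
  have h1 : t * (convexReg τ (A : Matrix (Fin m) (Fin n) 𝕜) + S) ≤
      t * (convexReg τ (X : Matrix (Fin m) (Fin n) 𝕜) + δ) := by
    have h2 := mul_le_mul_of_nonneg_left hεr ht0.le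
    have h3 := mul_lt_mul_of_pos_left htc ht0
    have h4 : 0 ≤ (t * r) ^ 2 := by positivity
    have h5 : t ^ 2 * c = q * (t ^ 2 * ‖M (X - A)‖ ^ 2) := by rw [hc]; ring
    have h6 : t * S = 2 * (t * RCLike.re (inner 𝕜 (halfNegGrad M h q A) (X - A))) := by
      rw [hS]; ring
    nlinarith
  exact le_of_mul_le_mul_left h1 ht0

theorem isStationaryPoint_iff (hτ : 0 ≤ τ) (hq : 1 < q) (A : H) :
    IsStationaryPoint 𝕜 (objective M h τ q) A ↔
      ∃ W : Matrix (Fin m) (Fin n) 𝕜, Function.IsFixedPt (fixedPointMap M h τ q) (W, A) := by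
  constructor
  · intro hA
    obtain ⟨W, hW, hP⟩ := exists_isHalfSubgradient_of_subspace hτ H A (halfNegGrad M h q A)
      (subgradient_of_isStationaryPoint M h hτ (by linarith) hA)
    exact ⟨W, (isFixedPt_iff M h hτ hq W A).2 ⟨hW, hP⟩⟩
  · rintro ⟨W, hW⟩
    obtain ⟨hW, hP⟩ := (isFixedPt_iff M h hτ hq W A).1 hW
    intro ε hε
    -- Radius `ε` suffices: the only loss is `‖X - A‖ ^ 2`, at most `ε * ‖X - A‖` on this ball.
    filter_upwards [Metric.ball_mem_nhds A hε] with X hX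
    rw [mem_ball_iff_norm] at hX
    have h1 := objective_ge_of_isHalfSubgradient M h (q := q) hW X
    rw [hP, sub_self, inner_zero_left, map_zero] at h1
    rw [inner_zero_left, map_zero]
    have h2 : 0 ≤ q * ‖M (X - A)‖ ^ 2 := by positivity
    nlinarith [norm_nonneg (X - A)]

/-- Any half subgradient works here, since its mismatch with the gradient of the quadratic goes into
`l`. -/
theorem objective_supporting (hτ : 0 ≤ τ) (A : H) :
    ∃ l : H →ₗ[ℝ] ℝ, ∀ X, objective M h τ q A + l (X - A) +
      (q * ‖M (X - A)‖ ^ 2 - ‖X - A‖ ^ 2) ≤ objective M h τ q X := by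
  obtain ⟨W, hW⟩ := exists_isHalfSubgradient hτ (A : Matrix (Fin m) (Fin n) 𝕜)
  exact ⟨(2 : ℝ) • (RCLike.reLm ∘ₗ
    ((innerₛₗ 𝕜 (H.orthogonalProjectionOnto W - halfNegGrad M h q A)).restrictScalars ℝ)),
    objective_ge_of_isHalfSubgradient M h hW⟩

theorem re_inner_smul_adjoint_comp_sub_id (D : H) :
    RCLike.re (inner 𝕜 (((q : 𝕜) • (LinearMap.adjoint M ∘ₗ M) - LinearMap.id : H →ₗ[𝕜] H) D) D) =
      q * ‖M D‖ ^ 2 - ‖D‖ ^ 2 := by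
  rw [LinearMap.sub_apply, LinearMap.smul_apply, LinearMap.comp_apply, LinearMap.id_apply,
    inner_sub_left, map_sub, re_inner_ofReal_smul_left,
    LinearMap.adjoint_inner_left, ← norm_sq_eq_re_inner, ← norm_sq_eq_re_inner]

end Objective

end LowRank

theorem theorem5p3 {𝕜 : Type*} [RCLike 𝕜] {m n : ℕ}
    (H : Submodule 𝕜 (Matrix (Fin m) (Fin n) 𝕜))
    {V : Type*} [NormedAddCommGroup V] [InnerProductSpace 𝕜 V] [FiniteDimensional 𝕜 V]
    (M : H →ₗ[𝕜] V) (h : V) {τ q : ℝ} (hτ : 0 < τ) (hq : 1 < q)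
    (hM : LinearMap.adjoint M ∘ₗ M ≤ LinearMap.id) :
    (∀ A : H, LowRank.IsStationaryPoint 𝕜 (LowRank.objective M h τ q) A ↔
      ∃ W : Matrix (Fin m) (Fin n) 𝕜,
        Function.IsFixedPt (LowRank.fixedPointMap M h τ q) (W, A)) ∧
    (LinearMap.id ≤ (q : 𝕜) • (LinearMap.adjoint M ∘ₗ M) →
      ConvexOn ℝ Set.univ (LowRank.objective M h τ q)) ∧
    (LowRank.StrictLoewner LinearMap.id ((q : 𝕜) • (LinearMap.adjoint M ∘ₗ M)) →
      StrictConvexOn ℝ Set.univ (LowRank.objective M h τ q)) := by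
  refine ⟨LowRank.isStationaryPoint_iff M h hτ.le hq, fun hc => ?_, fun hc => ?_⟩
  · refine LowRank.convexOn_of_supporting fun A => ?_
    obtain ⟨l, hl⟩ := LowRank.objective_supporting M h (q := q) hτ.le A
    refine ⟨l, fun X => ?_⟩
    have h1 := LinearMap.IsPositive.re_inner_nonneg_left (T := (q : 𝕜) • (LinearMap.adjoint M ∘ₗ M) - LinearMap.id) hc (X - A)
    rw [LowRank.re_inner_smul_adjoint_comp_sub_id] at h1
    linarith [hl X]
  · refine LowRank.strictConvexOn_of_supporting fun A => ?_
    obtain ⟨l, hl⟩ := LowRank.objective_supporting M h (q := q) hτ.le A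
    refine ⟨l, fun X hX => ?_⟩
    have h1 := hc.2 (X - A) (sub_ne_zero.2 hX)
    rw [LowRank.re_inner_smul_adjoint_comp_sub_id] at h1
    linarith [hl X]
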